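/- All digraphs are finite, with no loops and no multiple arcs (pairs of opposite arcs are allowed). A digraph $D$ is connected if it has a vertex and its underlying graph is connected, and contrafunctional if every vertex has in-degree $1$. Write $N^+[v]$ for the set consisting of $v$ and its out-neighbors. The domination number $\gamma(D)$ is the minimum size of a set $S\subseteq V(D)$ such that every vertex outside $S$ has an in-neighbor in $S$. The packing number $\rho(D)$ is the maximum size of a set $B\subseteq V(D)$ such that $|N^+[v]\cap B|\le 1$ for every $v\in V(D)$. A connected contrafunctional digraph $D$ has exactly one directed cycle $C$; its length is at least $2$. The distance of a vertex $v$ from $C$ is the least length of a directed path from a vertex of $C$ to $v$, and the height $h(D)$ is the maximum of these distances. A leaf is a vertex of out-degree $0$. A recursive directed-star elimination sequence of $D$ is a sequence $D_1,\dots,D_p$ ($p\ge 1$) of induced subdigraphs of $D$ such that $D_1=D$; for each $i<p$ one has $h(D_i)\ge 2$ and $D_{i+1}=D_i-N^+[u_i]$, where $u_i$ is the in-neighbor in $D_i$ of a leaf of $D_i$ at maximum distance from $C$; and $D_p$ is a directed cycle or has height $1$. (If $D$ is a directed cycle or has height $1$, the only such sequence is $D$ itself.) Let $\Omega$ be the family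 of all connected contrafunctional digraphs that have a recursive directed-star elimination sequence whose last term is a directed cycle of odd length. **Theorem.** For every connected contrafunctional digraph $D$, $$\gamma(D)=\begin{cases}\rho(D)+1 & \text{if } D\in\Omega,\\ \rho(D) & \text{if } D\notin\Omega.\end{cases}$$ -/

import Mathlib

namespace Digraph

variable {V : Type*}

/-- The digraph has no loops. -/
def Loopless (D : Digraph V) : Prop := ∀ v, ¬ D.Adj v v

/-- The in-neighborhood of `v`. -/
def inNbhd (D : Digraph V) (v : V) : Set V := {u | D.Adj u v}

/-- The out-neighborhood of `v`. -/
def outNbhd (D : Digraph V) (v : V) : Set V := {w | D.Adj v w}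

/-- The closed out-neighborhood of `v`. -/
def closedOutNbhd (D : Digraph V) (v : V) : Set V := insert v (D.outNbhd v)

/-- A digraph is connected if its underlying simple graph is connected
(in particular it has a vertex). -/
def IsConnected (D : Digraph V) : Prop := D.toSimpleGraphInclusive.Connected

/-- Every vertex has in-degree one. -/
def IsContrafunctional (D : Digraph V) : Prop := ∀ v, (D.inNbhd v).ncard = 1

/-- Every vertex outside `S` has an in-neighbor in `S`. -/
def IsDominating (D : Digraph V) (S : Set V) : Prop := ∀ v, v ∉ S → ∃ u ∈ S, D.Adj u v

/-- Every closed out-neighborhood meets `B` in at most one vertex. -/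
def IsPacking (D : Digraph V) (B : Set V) : Prop := ∀ v, (D.closedOutNbhd v ∩ B).encard ≤ 1

/-- The minimum cardinality of a dominating set (the digraph being finite). -/
noncomputable def dominationNumber (D : Digraph V) : ℕ :=
  sInf {n | ∃ S : Finset V, D.IsDominating S ∧ S.card = n}

/-- The maximum cardinality of a packing set (the digraph being finite). -/
noncomputable def packingNumber (D : Digraph V) : ℕ :=
  sSup {n | ∃ B : Finset V, D.IsPacking B ∧ B.card = n}

/-- The subdigraph induced by a set of vertices. -/
def induce (D : Digraph V) (S : Set V) : Digraph S where
  Adj a b := D.Adj a b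

/-- `D` is the directed cycle of length `k ≥ 2`. -/
def IsDirectedCycle (D : Digraph V) (k : ℕ) : Prop :=
  2 ≤ k ∧ ∃ c : ZMod k ≃ V, ∀ i j, D.Adj (c i) (c j) ↔ j = i + 1

/-- The vertices that lie on a directed cycle of `D`. A connected contrafunctional loopless
digraph has exactly one directed cycle `C`, and this is then the vertex set of `C`. -/
def cycleVertices (D : Digraph V) : Set V :=
  {v | ∃ k, 2 ≤ k ∧ ∃ c : ZMod k → V,
    Function.Injective c ∧ (∀ i, D.Adj (c i) (c (i + 1))) ∧ v ∈ Set.range c}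

/-- `D.HasWalk n u v`: there is a directed walk of length `n` from `u` to `v`. -/
inductive HasWalk (D : Digraph V) : ℕ → V → V → Prop
  | nil (u : V) : HasWalk D 0 u u
  | snoc {n : ℕ} {u v w : V} : HasWalk D n u v → D.Adj v w → HasWalk D (n + 1) u w

/-- The directed distance from the cycle of `D` to `v`: the least length of a directed walk
that starts at a vertex of the cycle and ends at `v` (infinite if there is none). -/
noncomputable def cycleDist (D : Digraph V) (v : V) : ℕ∞ :=
  ⨅ (n : ℕ) (_ : ∃ c ∈ D.cycleVertices, D.HasWalk n c v), (n : ℕ∞)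

/-- The largest distance of a vertex from the cycle. -/
noncomputable def height (D : Digraph V) : ℕ∞ := ⨆ v, D.cycleDist v

/-- A leaf is a vertex of out-degree zero. -/
def IsLeaf (D : Digraph V) (v : V) : Prop := D.outNbhd v = ∅

/-- One step of directed-star elimination, from the subdigraph induced by `S` to the one induced
by `S'`: the former has height at least two, `v` is one of its leaves at maximum distance from
the cycle, `u` is the in-neighbor of `v`, and the closed out-neighborhood of `u` is deleted. -/
def StarElimStep (D : Digraph V) (S S' : Set V) : Prop :=
  2 ≤ (D.induce S).height ∧
    ∃ v u : S, (D.induce S).IsLeaf v ∧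
      (∀ w : S, (D.induce S).cycleDist w ≤ (D.induce S).cycleDist v) ∧
      (D.induce S).Adj u v ∧
      S' = S \ D.closedOutNbhd u

/-- A recursive directed-star elimination sequence of `D` with `p` steps, each term being given by
its vertex set. It starts at `D` and stops at a directed cycle or at a digraph of height one.
For `p = 0` it consists of `D` alone. -/
structure IsRDSES (D : Digraph V) (p : ℕ) (S : Fin (p + 1) → Set V) : Prop where
  start : S 0 = Set.univ
  step : ∀ i : Fin p, D.StarElimStep (S i.castSucc) (S i.succ)
  last : (∃ k, (D.induce (S (Fin.last p))).IsDirectedCycle k) ∨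
    (D.induce (S (Fin.last p))).height = 1

/-- The family `Ω`: the connected contrafunctional digraphs that have a recursive directed-star
elimination sequence whose last term is a directed cycle of odd length. -/
def MemOmega (D : Digraph V) : Prop :=
  D.Loopless ∧ D.IsConnected ∧ D.IsContrafunctional ∧
    ∃ (p : ℕ) (S : Fin (p + 1) → Set V), D.IsRDSES p S ∧
      ∃ k, Odd k ∧ (D.induce (S (Fin.last p))).IsDirectedCycle k

end Digraph

/-!
A contrafunctional digraph is the graph of a map `f`, its parent map, which sends a vertex to its
unique in-neighbor. A set is dominating if and only if it meets `{x, f x}` for all vertices `x`, and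
`B` is a packing if and only if the pairs `{x, f x}` with `x ∈ B` are pairwise disjoint. So the
domination number is a vertex cover number, the packing number is a matching number, and the latter
is at most the former (`IsParentMap.card_le_card`).

Equality is witnessed by a kernel, a set `K` to which a vertex belongs exactly if none of its
children does: the complement of `K` is dominating, and choosing for each of its vertices a child in
`K` gives a packing of the same size (`IsParentMap.exists_card_eq_of_isKernelOn`). A directed cycle
of even length has a kernel. So does a digraph in which some cycle vertex has a leaf as a child,
since the leaf keeps its parent out of the kernel and this breaks the cycle
(`exists_isKernelOn_of_leaf`). A directed cycle of odd length has none, and there the two numbers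
differ by one (`IsParentMap.hasUnitGap_of_odd`).

An elimination step removes a star that hangs from the rest of the digraph at its center. The rest
is closed under `f`, a kernel of the rest extends to the star
(`IsPendantStar.exists_isKernelOn`), and both numbers drop by exactly one
(`IsPendantStar.hasUnitGap`). When no step applies, either a directed cycle is left or some cycle
vertex has a leaf as a child. In the latter case, and when the cycle is even, there is a kernel; an
odd cycle shows that the digraph belongs to `Ω` (`IsParentMap.exists_reflTransGen_or_isKernelOn`).
-/

namespace Digraph

open Function

variable {V : Type*}

/-! ### The parent map of a contrafunctional digraph -/

/-- `f` sends every vertex of `D` to its unique in-neighbor. -/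
def IsParentMap (D : Digraph V) (f : V → V) : Prop := ∀ u v, D.Adj u v ↔ f v = u

theorem IsContrafunctional.exists_isParentMap {D : Digraph V} (h : D.IsContrafunctional) :
    ∃ f, D.IsParentMap f := by
  choose f hf using fun v => Set.ncard_eq_one.1 (h v)
  refine ⟨f, fun u v => ?_⟩
  have : u ∈ D.inNbhd v ↔ u = f v := by rw [hf v, Set.mem_singleton_iff]
  exact this.trans eq_comm

namespace IsParentMap

variable {D : Digraph V} {f : V → V}

theorem adj (hf : D.IsParentMap f) (v : V) : D.Adj (f v) v := (hf _ _).2 rfl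

theorem apply_ne (hf : D.IsParentMap f) (hloop : D.Loopless) (v : V) : f v ≠ v :=
  fun h => hloop v ((hf v v).2 h)

theorem mem_closedOutNbhd (hf : D.IsParentMap f) {v w : V} :
    w ∈ D.closedOutNbhd v ↔ w = v ∨ f w = v := by
  exact or_congr_right (hf v w)

theorem isDominating_iff (hf : D.IsParentMap f) {T : Set V} :
    D.IsDominating T ↔ ∀ x, x ∈ T ∨ f x ∈ T := by
  simp only [IsDominating, hf _ _]
  refine forall_congr' fun v => ?_
  rw [or_iff_not_imp_left]
  simp

theorem isPacking_iff (hf : D.IsParentMap f) {B : Set V} :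
    D.IsPacking B ↔ ∀ x ∈ B, ∀ y ∈ B, f x = f y ∨ f x = y → x = y := by
  simp only [IsPacking, Set.encard_le_one_iff, Set.mem_inter_iff, hf.mem_closedOutNbhd]
  constructor
  · intro h x hx y hy hxy
    exact h (f x) x y ⟨.inr rfl, hx⟩ ⟨hxy.elim (fun h => .inr h.symm) (fun h => .inl h.symm), hy⟩
  · rintro h v x y ⟨hx | hx, hxB⟩ ⟨hy | hy, hyB⟩
    · exact hx.trans hy.symm
    · exact (h y hyB x hxB (.inr (hy.trans hx.symm))).symm
    · exact h x hxB y hyB (.inr (hx.trans hy.symm))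
    · exact h x hxB y hyB (.inl (hx.trans hy.symm))

theorem hasWalk_iff (hf : D.IsParentMap f) {n : ℕ} {u v : V} :
    D.HasWalk n u v ↔ f^[n] v = u := by
  induction n generalizing v with
  | zero =>
    constructor
    · rintro ⟨⟩
      rfl
    · rintro rfl
      exact .nil _
  | succ n ih =>
    rw [iterate_succ_apply]
    constructor
    · rintro (_ | ⟨h, h'⟩)
      rw [(hf _ _).1 h']
      exact ih.1 h
    · exact fun h => .snoc (ih.2 h) (hf.adj v)

/-- In a connected digraph, the forward orbits of the parent map from any two vertices meet. -/
theorem exists_iterate_eq (hf : D.IsParentMap f) (hconn : D.IsConnected) (x y : V) :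
    ∃ m n, f^[m] x = f^[n] y := by
  have h := hconn.preconnected x y
  rw [SimpleGraph.reachable_iff_reflTransGen] at h
  induction h with
  | refl => exact ⟨0, 0, rfl⟩
  | @tail b c _ hbc ih =>
    obtain ⟨m, n, h⟩ := ih
    have hbc' : D.Adj b c ∨ D.Adj c b := by
      simpa [Digraph.toSimpleGraphInclusive] using hbc.2
    rcases hbc' with hbc' | hbc'
    · refine ⟨m, n + 1, ?_⟩
      rw [h, iterate_succ_apply, (hf _ _).1 hbc']
    · refine ⟨m + 1, n, ?_⟩
      rw [iterate_succ_apply', h, ← iterate_succ_apply' f, iterate_succ_apply, (hf _ _).1 hbc']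

theorem exists_iterate_eq_of_mem_periodicPts (hf : D.IsParentMap f) (hconn : D.IsConnected)
    {p : V} (hp : p ∈ periodicPts f) (x : V) : ∃ n, f^[n] x = p := by
  obtain ⟨m, n, h⟩ := hf.exists_iterate_eq hconn x p
  obtain ⟨k, hk, hkp⟩ := hp
  -- `k * n - n` further steps complete a whole number of turns of the cycle through `p`.
  refine ⟨(k * n - n) + m, ?_⟩
  rw [iterate_add_apply, h, ← iterate_add_apply, Nat.sub_add_cancel (Nat.le_mul_of_pos_left n hk)]
  exact hkp.mul_const n

theorem induce (hf : D.IsParentMap f) {S : Set V} (hS : Set.MapsTo f S S) :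
    (D.induce S).IsParentMap (hS.restrict f S S) := fun u v => by
  rw [Subtype.ext_iff]
  exact hf u v

end IsParentMap

/-! ### The cycle and the distance from it -/

/-- The periodic orbit of `x` under `f`, enumerated against the direction of `f`. -/
theorem exists_zmod_orbit {f : V → V} {x : V} (hx : x ∈ periodicPts f) :
    ∃ c : ZMod (minimalPeriod f x) → V, Injective c ∧ (∀ i, f (c (i + 1)) = c i) ∧
      ∀ n, f^[n] x ∈ Set.range c := by
  have : NeZero (minimalPeriod f x) := ⟨(minimalPeriod_pos_of_mem_periodicPts hx).ne'⟩
  refine ⟨fun i => f^[(-i).val] x, fun i j h => ?_, fun i => ?_, fun n => ⟨-n, ?_⟩⟩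
  · exact neg_injective (ZMod.val_injective _ (iterate_injOn_Iio_minimalPeriod
      (ZMod.val_lt (-i)) (ZMod.val_lt (-j)) h))
  · have : -i = -(i + 1) + 1 := by ring
    simp only
    rw [this, ZMod.val_add, ZMod.val_one_eq_one_mod, Nat.add_mod_mod, iterate_mod_minimalPeriod_eq]
    exact (iterate_succ_apply' f _ x).symm
  · simp only [neg_neg]
    rw [ZMod.val_natCast, iterate_mod_minimalPeriod_eq]

theorem IsParentMap.cycleVertices_eq {D : Digraph V} {f : V → V} (hf : D.IsParentMap f)
    (hloop : D.Loopless) : D.cycleVertices = periodicPts f := by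
  ext v
  constructor
  · rintro ⟨k, hk, c, -, hc, i, rfl⟩
    have hit : ∀ n : ℕ, f^[n] (c i) = c (i - n) := by
      intro n
      induction n with
      | zero => simp
      | succ n ih =>
        rw [iterate_succ_apply', ih, ← hf]
        convert hc (i - (n + 1 : ℕ)) using 2
        push_cast
        ring
    refine ⟨k, by omega, ?_⟩
    rw [IsPeriodicPt, IsFixedPt, hit, ZMod.natCast_self, sub_zero]
  · intro hv
    obtain ⟨c, hc, hstep, hmem⟩ := exists_zmod_orbit hv
    have h0 := minimalPeriod_pos_of_mem_periodicPts hv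
    have h1 : minimalPeriod f v ≠ 1 := fun h =>
      hf.apply_ne hloop v (minimalPeriod_eq_one_iff_isFixedPt.1 h)
    exact ⟨_, by omega, c, hc, fun i => (hf _ _).2 (hstep i), hmem 0⟩

/-- The least number of iterations of `f` that take `v` to a periodic point. -/
noncomputable def cycleDepth (f : V → V) (v : V) : ℕ := sInf {n | f^[n] v ∈ periodicPts f}

theorem exists_iterate_mem_periodicPts [Finite V] (f : V → V) (v : V) :
    ∃ n, f^[n] v ∈ periodicPts f := by
  obtain ⟨i, j, hij, h⟩ := Finite.exists_ne_map_eq_of_infinite fun n : ℕ => f^[n] v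
  wlog hlt : i < j generalizing i j
  · exact this j i hij.symm h.symm (by omega)
  refine ⟨i, j - i, by omega, ?_⟩
  rw [IsPeriodicPt, IsFixedPt, ← iterate_add_apply, Nat.sub_add_cancel hlt.le]
  exact h.symm

theorem iterate_cycleDepth_mem [Finite V] (f : V → V) (v : V) :
    f^[cycleDepth f v] v ∈ periodicPts f :=
  Nat.sInf_mem (exists_iterate_mem_periodicPts f v)

theorem cycleDepth_le {f : V → V} {v : V} {n : ℕ} (h : f^[n] v ∈ periodicPts f) :
    cycleDepth f v ≤ n :=
  Nat.sInf_le h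

theorem cycleDepth_eq_zero_iff [Finite V] {f : V → V} {v : V} :
    cycleDepth f v = 0 ↔ v ∈ periodicPts f := by
  refine ⟨fun h => ?_, fun h => Nat.le_zero.1 (cycleDepth_le (n := 0) h)⟩
  have := iterate_cycleDepth_mem f v
  rwa [h] at this

theorem cycleDepth_eq_succ [Finite V] {f : V → V} {v : V} (hv : v ∉ periodicPts f) :
    cycleDepth f v = cycleDepth f (f v) + 1 := by
  refine le_antisymm (cycleDepth_le (iterate_cycleDepth_mem f (f v))) ?_
  obtain ⟨m, hm⟩ := Nat.exists_eq_succ_of_ne_zero (mt cycleDepth_eq_zero_iff.1 hv)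
  have h := iterate_cycleDepth_mem f v
  rw [hm] at h ⊢
  exact Nat.succ_le_succ (cycleDepth_le h)

theorem IsParentMap.cycleDist_eq [Finite V] {D : Digraph V} {f : V → V} (hf : D.IsParentMap f)
    (hloop : D.Loopless) (v : V) : D.cycleDist v = cycleDepth f v := by
  have key : ∀ n, (∃ c ∈ D.cycleVertices, D.HasWalk n c v) ↔ f^[n] v ∈ periodicPts f := by
    intro n
    simp [hf.cycleVertices_eq hloop, hf.hasWalk_iff]
  simp only [cycleDist, key]
  refine le_antisymm (iInf₂_le (cycleDepth f v) ?_) (le_iInf₂ fun n hn => ?_)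
  · exact iterate_cycleDepth_mem f v
  · exact_mod_cast cycleDepth_le hn

theorem apply_mem_periodicPts {f : V → V} {v : V} (h : v ∈ periodicPts f) :
    f v ∈ periodicPts f := by
  obtain ⟨n, hn, h⟩ := h
  exact ⟨n, hn, h.apply⟩

/-! ### Pendant stars -/

/-- Within `S`, the vertex `u` has the child `v`, and no child of `u` has a child: the closed
out-neighborhood of `u` is a star that hangs from the rest of `S` at its center `u`. -/
structure IsPendantStar (f : V → V) (S : Set V) (u v : V) : Prop where
  center_mem : u ∈ S
  leaf_mem : v ∈ S
  apply_leaf : f v = u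
  apply_ne : ∀ x ∈ S, f x = u → ∀ w ∈ S, f w ≠ x

theorem induce_loopless {D : Digraph V} (hloop : D.Loopless) (S : Set V) :
    (D.induce S).Loopless := fun v => hloop v

/-- An elimination step removes a pendant star. -/
theorem StarElimStep.exists_isPendantStar [Finite V] {D : Digraph V} {f : V → V}
    (hf : D.IsParentMap f) (hloop : D.Loopless) {S S' : Set V} (hS : Set.MapsTo f S S)
    (h : D.StarElimStep S S') :
    ∃ u v, IsPendantStar f S u v ∧ S' = S \ D.closedOutNbhd u := by
  obtain ⟨hh, v, u, -, hmax, hadj, rfl⟩ := h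
  have hg := hf.induce hS
  set g := hS.restrict f S S
  simp only [hg.cycleDist_eq (induce_loopless hloop S), Nat.cast_le] at hmax
  have hv2 : 2 ≤ cycleDepth g v := by
    have := hh.trans (iSup_le fun w => by
      rw [hg.cycleDist_eq (induce_loopless hloop S)]
      exact Nat.cast_le.2 (hmax w))
    exact_mod_cast this
  have hgv : g v = u := (hg _ _).1 hadj
  have hvs : cycleDepth g v = cycleDepth g u + 1 := by
    rw [← hgv]
    exact cycleDepth_eq_succ fun h => by
      have := cycleDepth_eq_zero_iff.2 h
      omega
  have hu : u ∉ periodicPts g := fun h => by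
    have := cycleDepth_eq_zero_iff.2 h
    omega
  refine ⟨u, v, ⟨u.2, v.2, congrArg Subtype.val hgv, fun x hx hxu w hw hwx => ?_⟩, rfl⟩
  -- A grandchild `w` of `u` would be farther from the cycle than `v`.
  have hxu' : g ⟨x, hx⟩ = u := Subtype.ext hxu
  have hwx' : g ⟨w, hw⟩ = ⟨x, hx⟩ := Subtype.ext hwx
  have hxp : (⟨x, hx⟩ : S) ∉ periodicPts g := fun h => hu (hxu' ▸ apply_mem_periodicPts h)
  have hwp : (⟨w, hw⟩ : S) ∉ periodicPts g := fun h => hxp (hwx' ▸ apply_mem_periodicPts h)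
  have h1 := cycleDepth_eq_succ hxp
  have h2 := cycleDepth_eq_succ hwp
  have h3 := hmax ⟨w, hw⟩
  rw [hxu'] at h1
  rw [hwx'] at h2
  omega

theorem exists_starElimStep [Finite V] {D : Digraph V} {f : V → V}
    (hf : D.IsParentMap f) (hloop : D.Loopless) {S : Set V} (hS : Set.MapsTo f S S)
    (h : 2 ≤ (D.induce S).height) : ∃ S', D.StarElimStep S S' := by
  have hg := hf.induce hS
  set g := hS.restrict f S S
  have hne : Nonempty S := by
    by_contra hne
    rw [not_nonempty_iff] at hne
    rw [height, iSup_of_empty] at h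
    exact absurd h (by simp)
  obtain ⟨v, hv⟩ := Finite.exists_max (cycleDepth g)
  have hmax : ∀ w, (D.induce S).cycleDist w ≤ (D.induce S).cycleDist v := fun w => by
    simpa only [hg.cycleDist_eq (induce_loopless hloop S), Nat.cast_le] using hv w
  refine ⟨_, h, v, g v, ?_, hmax, hg.adj v, rfl⟩
  have hv2 : 2 ≤ cycleDepth g v := by
    have := h.trans (iSup_le hmax)
    rw [hg.cycleDist_eq (induce_loopless hloop S)] at this
    exact_mod_cast this
  refine Set.eq_empty_of_forall_notMem fun w hw => ?_
  have hw : g w = v := (hg _ _).1 hw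
  have hwp : w ∉ periodicPts g := fun h => by
    have := cycleDepth_eq_zero_iff.2 (hw ▸ apply_mem_periodicPts h)
    omega
  have h1 := cycleDepth_eq_succ hwp
  have h2 := hv w
  rw [hw] at h1
  omega

namespace IsPendantStar

variable {D : Digraph V} {f : V → V} {S : Set V} {u v : V}

theorem mapsTo_diff (h : IsPendantStar f S u v) (hf : D.IsParentMap f) (hS : Set.MapsTo f S S) :
    Set.MapsTo f (S \ D.closedOutNbhd u) (S \ D.closedOutNbhd u) := by
  rintro x ⟨hx, hxu⟩
  refine ⟨hS hx, fun hfx => ?_⟩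
  rw [hf.mem_closedOutNbhd] at hxu hfx
  rcases hfx with hfx | hfx
  · exact hxu (.inr hfx)
  · exact h.apply_ne _ (hS hx) hfx x hx rfl

theorem nonempty_diff (h : IsPendantStar f S u v) (hf : D.IsParentMap f) (hloop : D.Loopless)
    (hS : Set.MapsTo f S S) : (S \ D.closedOutNbhd u).Nonempty := by
  refine ⟨f u, hS h.center_mem, fun hfu => ?_⟩
  rw [hf.mem_closedOutNbhd] at hfu
  rcases hfu with hfu | hfu
  · exact hf.apply_ne hloop u hfu
  · exact h.apply_ne _ (hS h.center_mem) hfu u h.center_mem rfl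

end IsPendantStar

/-- A set closed under taking parents to which no elimination step applies induces a directed
cycle, or contains a leaf whose parent lies on the cycle of the whole digraph. -/
theorem isDirectedCycle_or_exists_leaf [Finite V] {D : Digraph V} {f : V → V}
    (hf : D.IsParentMap f) (hloop : D.Loopless) (hconn : D.IsConnected) {S : Set V}
    (hS : Set.MapsTo f S S) (hne : S.Nonempty) (h : ¬ 2 ≤ (D.induce S).height) :
    (∃ k, (D.induce S).IsDirectedCycle k) ∨
      ∃ v ∈ S, (∀ w ∈ S, f w ≠ v) ∧ f v ∈ periodicPts f := by
  have hg := hf.induce hS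
  have hgloop := induce_loopless hloop S
  set g := hS.restrict f S S
  have hval : Semiconj Subtype.val g f := fun _ => rfl
  have hper : ∀ x, x ∈ periodicPts g → (x : V) ∈ periodicPts f := by
    rintro x ⟨n, hn, hx⟩
    exact ⟨n, hn, hx.map hval⟩
  have hle : ∀ w, cycleDepth g w ≤ 1 := by
    intro w
    by_contra! hw
    refine h (le_trans ?_ (le_iSup _ w))
    rw [hg.cycleDist_eq hgloop]
    exact_mod_cast hw
  by_cases hall : ∀ x, x ∈ periodicPts g
  · left
    obtain ⟨x, hx⟩ := hne
    lift x to S using hx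
    obtain ⟨c, hc, hstep, hmem⟩ := exists_zmod_orbit (hall x)
    have h0 := minimalPeriod_pos_of_mem_periodicPts (hall x)
    have h1 : minimalPeriod g x ≠ 1 := fun h =>
      hg.apply_ne hgloop x (minimalPeriod_eq_one_iff_isFixedPt.1 h)
    have hsurj : Surjective c := fun y => by
      obtain ⟨n, hn⟩ := hf.exists_iterate_eq_of_mem_periodicPts hconn (hper y (hall y)) x
      have : g^[n] x = y := Subtype.ext (((hval.iterate_right n) x).trans hn)
      exact this ▸ hmem n
    refine ⟨_, by omega, Equiv.ofBijective c ⟨hc, hsurj⟩, fun i j => ?_⟩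
    have : g (c j) = c (j - 1) := by
      rw [← hstep (j - 1), sub_add_cancel]
    refine (hg (c i) (c j)).trans ?_
    rw [this, hc.eq_iff, sub_eq_iff_eq_add]
  · right
    push Not at hall
    obtain ⟨v, hv⟩ := hall
    have hvs := cycleDepth_eq_succ hv
    have hv1 := hle v
    refine ⟨v, v.2, ?_, ?_⟩
    · intro w hw hwv
      have hwv' : g ⟨w, hw⟩ = v := Subtype.ext hwv
      have h1 := cycleDepth_eq_succ (f := g) (v := ⟨w, hw⟩)
        fun h => hv (hwv' ▸ apply_mem_periodicPts h)
      have h2 := hle ⟨w, hw⟩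
      rw [hwv'] at h1
      omega
    · exact hper (g v) (cycleDepth_eq_zero_iff.1 (by omega))

/-! ### Kernels -/

/-- `K` is a kernel of the digraph induced by `S`: a vertex of `S` belongs to `K` exactly if none
of its children in `S` does. Elements of `K` outside `S` are irrelevant. -/
def IsKernelOn (f : V → V) (S K : Set V) : Prop :=
  ∀ u ∈ S, u ∈ K ↔ ∀ v ∈ S, f v = u → v ∉ K

/-- A kernel survives the insertion of a pendant star: its leaves are put into the kernel. -/
theorem IsPendantStar.exists_isKernelOn {D : Digraph V} {f : V → V} {S K : Set V} {u v : V}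
    (h : IsPendantStar f S u v) (hf : D.IsParentMap f) (hloop : D.Loopless)
    (hK : IsKernelOn f (S \ D.closedOutNbhd u) K) : ∃ K', IsKernelOn f S K' := by
  refine ⟨{w | w ≠ u ∧ (f w = u ∨ w ∈ K)}, fun w hw => ?_⟩
  have hvu : v ≠ u := fun e => hf.apply_ne hloop v (h.apply_leaf.trans e.symm)
  by_cases hwu : w = u
  · subst hwu
    exact iff_of_false (fun h' => h'.1 rfl)
      fun h' => h' v h.leaf_mem h.apply_leaf ⟨hvu, .inl h.apply_leaf⟩
  by_cases hfw : f w = u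
  · exact iff_of_true ⟨hwu, .inl hfw⟩ fun x hx hxw => absurd hxw (h.apply_ne w hw hfw x hx)
  have hmem : ∀ {x}, x ∈ S → x ≠ u → f x ≠ u → x ∈ S \ D.closedOutNbhd u := fun hx h1 h2 =>
    ⟨hx, fun h' => (hf.mem_closedOutNbhd.1 h').elim h1 h2⟩
  have hw' := hK w (hmem hw hwu hfw)
  constructor
  · rintro ⟨-, h' | h'⟩ x hx hxw ⟨hxu, h'' | h''⟩
    · exact hfw h'
    · exact hfw h'
    · exact hwu (hxw ▸ h'')
    · exact hw'.1 h' x (hmem hx hxu (hxw ▸ hwu)) hxw h''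
  · intro h'
    refine ⟨hwu, .inr (hw'.2 fun x hx hxw hxK => h' x hx.1 hxw ⟨fun e => ?_, .inr hxK⟩)⟩
    exact hx.2 (hf.mem_closedOutNbhd.2 (.inl e))

/-- The enumeration of a directed cycle, expressed with the parent map. -/
theorem IsParentMap.exists_enum_of_isDirectedCycle {D : Digraph V} {f : V → V}
    (hf : D.IsParentMap f) {S : Set V} {k : ℕ} (h : (D.induce S).IsDirectedCycle k) :
    ∃ c : ZMod k → V, Injective c ∧ Set.range c = S ∧ ∀ i, f (c (i + 1)) = c i := by
  obtain ⟨-, c, hc⟩ := h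
  refine ⟨fun i => c i, Subtype.val_injective.comp c.injective, ?_, fun i => ?_⟩
  · ext x
    exact ⟨fun ⟨i, hi⟩ => hi ▸ (c i).2, fun hx => ⟨c.symm ⟨x, hx⟩, by simp⟩⟩
  · exact (hf _ _).1 ((hc i (i + 1)).2 rfl)

theorem IsParentMap.exists_isKernelOn_of_even {D : Digraph V} {f : V → V} (hf : D.IsParentMap f)
    {S : Set V} {k : ℕ} (h : (D.induce S).IsDirectedCycle k) (hk : Even k) :
    ∃ K, IsKernelOn f S K := by
  obtain ⟨c, hc, rfl, hstep⟩ := hf.exists_enum_of_isDirectedCycle h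
  -- As `k` is even, residues modulo `k` have a well-defined parity.
  let φ := ZMod.castHom hk.two_dvd (ZMod 2)
  have hmem : ∀ i, c i ∈ c '' {i | φ i = 1} ↔ φ i = 1 := fun i => hc.mem_set_image
  refine ⟨c '' {i | φ i = 1}, ?_⟩
  rintro _ ⟨i, rfl⟩
  have key : ∀ a : ZMod 2, a = 1 ↔ ¬ a + 1 = 1 := by decide
  rw [hmem, key]
  constructor
  · rintro h' _ ⟨j, rfl⟩ hj
    have : j = i + 1 := by
      rw [← sub_add_cancel j 1, hstep] at hj
      rw [← hc hj, sub_add_cancel]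
    rwa [this, hmem, map_add, map_one]
  · intro h'
    have := h' _ ⟨i + 1, rfl⟩ (hstep i)
    rwa [hmem, map_add, map_one] at this

/-- Along a well-founded relation, membership in a kernel can be decided recursively, even when
the vertices that violate `P` are barred from it. -/
theorem exists_kernel_of_wellFounded {r : V → V → Prop} (hr : WellFounded r) (P : V → Prop) :
    ∃ K : Set V, ∀ u, u ∈ K ↔ P u ∧ ∀ v, r v u → v ∉ K := by
  refine ⟨{u | hr.fix (fun u ih => P u ∧ ∀ v (h : r v u), ¬ ih v h) u}, fun u => ?_⟩
  exact iff_of_eq (hr.fix_eq (fun u ih => P u ∧ ∀ v (h : r v u), ¬ ih v h) u)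

/-- If `p` is an ancestor of all vertices of `S` and has a child that is a leaf, then `S` has a
kernel: this leaf keeps `p` out of it, which determines it on all other vertices. -/
theorem exists_isKernelOn_of_leaf [Finite V] {f : V → V} {S : Set V} {p v : V}
    (hp : ∀ x ∈ S, ∃ n, f^[n] x = p) (hv : v ∈ S) (hleaf : ∀ w ∈ S, f w ≠ v) (hfv : f v = p) :
    ∃ K, IsKernelOn f S K := by
  let N : V → ℕ := fun x => sInf {n | f^[n] x = p}
  obtain ⟨M, hM⟩ : ∃ M, ∀ x, N x ≤ M := by
    obtain ⟨M, hM⟩ := (Set.finite_range N).bddAbove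
    exact ⟨M, fun x => hM ⟨x, rfl⟩⟩
  have hwf : WellFounded fun x u => x ∈ S ∧ f x = u ∧ u ≠ p := by
    classical
    -- Away from `p`, the number of steps to reach `p` grows by one from parent to child.
    refine Subrelation.wf ?_ (measure fun x => if x = p then 0 else M + 1 - N x).wf
    rintro x u ⟨hx, rfl, hne⟩
    simp only [WellFoundedRelation.rel, InvImage, if_neg hne]
    have h1 := hM x
    have h2 := hM (f x)
    split_ifs with hxp
    · omega
    have hN : f^[N x] x = p := Nat.sInf_mem (hp x hx)
    have hN0 : N x ≠ 0 := fun h0 => hxp (by rwa [h0] at hN)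
    obtain ⟨n, hn⟩ := Nat.exists_eq_succ_of_ne_zero hN0
    rw [hn] at hN
    have : N (f x) ≤ n := Nat.sInf_le hN
    omega
  obtain ⟨K, hK⟩ := exists_kernel_of_wellFounded hwf (· ≠ p)
  refine ⟨K, fun u _ => ?_⟩
  by_cases hup : u = p
  · subst hup
    refine iff_of_false (fun h => ((hK _).1 h).1 rfl) fun h => h v hv hfv ?_
    exact (hK v).2 ⟨fun e => hleaf v hv (hfv.trans e.symm), fun w hw => absurd hw.2.1 (hleaf w hw.1)⟩
  · rw [hK]
    exact ⟨fun h x hx hxu => h.2 x ⟨hx, hxu, hup⟩, fun h => ⟨hup, fun x hx => h x hx.1 hx.2.1⟩⟩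

/-! ### Domination and packing numbers -/

/-- Choosing for every vertex outside a kernel a child inside gives a packing of the size of the
complement of the kernel, which is dominating. -/
theorem IsParentMap.exists_card_eq_of_isKernelOn [Finite V] {D : Digraph V} {f : V → V}
    (hf : D.IsParentMap f) {K : Set V} (hK : IsKernelOn f Set.univ K) :
    ∃ T B : Finset V, D.IsDominating T ∧ D.IsPacking B ∧ T.card = B.card := by
  classical
  have := Fintype.ofFinite V
  have hch : ∀ u, ∃ v, u ∉ K → f v = u ∧ v ∈ K := by
    intro u
    by_cases hu : u ∈ K
    · exact ⟨u, fun h => absurd hu h⟩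
    · have := mt (hK u trivial).2 hu
      push Not at this
      obtain ⟨v, -, h1, h2⟩ := this
      exact ⟨v, fun _ => ⟨h1, h2⟩⟩
  choose b hb using hch
  let T : Finset V := Finset.univ.filter (· ∉ K)
  have hT : ∀ x, x ∈ T ↔ x ∉ K := fun x => by simp [T]
  refine ⟨T, T.image b, hf.isDominating_iff.2 fun x => ?_, hf.isPacking_iff.2 ?_,
    (Finset.card_image_of_injOn fun x hx y hy hxy => ?_).symm⟩
  · rw [Finset.mem_coe, Finset.mem_coe, hT, hT, or_iff_not_imp_left, not_not]
    intro hx hfx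
    exact (hK _ trivial).1 hfx x trivial rfl hx
  · simp only [Finset.mem_coe, Finset.mem_image, hT]
    rintro _ ⟨x, hx, rfl⟩ _ ⟨y, hy, rfl⟩ h
    rw [(hb x hx).1, (hb y hy).1] at h
    rcases h with rfl | rfl
    · rfl
    · exact absurd (hb y hy).2 hx
  · have hx := (hT x).1 hx
    have hy := (hT y).1 hy
    rw [← (hb x hx).1, ← (hb y hy).1]
    exact congrArg f hxy

theorem IsParentMap.card_le_card {D : Digraph V} {f : V → V} (hf : D.IsParentMap f)
    {T B : Finset V} (hT : D.IsDominating T) (hB : D.IsPacking B) : B.card ≤ T.card := by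
  classical
  rw [hf.isDominating_iff] at hT
  rw [hf.isPacking_iff] at hB
  refine Finset.card_le_card_of_injOn (fun x => if x ∈ T then x else f x) (fun x _ => ?_)
    fun x hx y hy hxy => ?_
  · simp only
    split_ifs with h
    · exact h
    · exact (hT x).resolve_left h
  · simp only at hxy
    split_ifs at hxy
    · exact hxy
    · exact (hB y hy x hx (.inr hxy.symm)).symm
    · exact hB x hx y hy (.inr hxy)
    · exact hB x hx y hy (.inl hxy)

theorem dominationNumber_eq_packingNumber_add [Finite V] {D : Digraph V} {e : ℕ}
    {T B : Finset V} (hT : D.IsDominating T) (hB : D.IsPacking B) (hTB : T.card ≤ B.card + e)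
    (h : ∀ T B : Finset V, D.IsDominating T → D.IsPacking B → B.card + e ≤ T.card) :
    D.dominationNumber = D.packingNumber + e := by
  have h1 : D.dominationNumber = T.card := by
    refine le_antisymm (Nat.sInf_le ⟨T, hT, rfl⟩) (le_csInf ⟨_, T, hT, rfl⟩ ?_)
    rintro _ ⟨T', hT', rfl⟩
    exact hTB.trans (h T' B hT' hB)
  have hub : B.card ∈ upperBounds {n | ∃ B : Finset V, D.IsPacking B ∧ B.card = n} := by
    rintro _ ⟨B', hB', rfl⟩
    have := h T B' hT hB'
    omega
  have h2 : D.packingNumber = B.card :=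
    le_antisymm (csSup_le ⟨_, B, hB, rfl⟩ hub) (le_csSup ⟨_, hub⟩ ⟨B, hB, rfl⟩)
  have := h T B hT hB
  omega

/-! ### The gap created by an odd cycle -/

/-- In the digraph induced by `S`, the domination number exceeds the packing number by one. A set
`T` dominates it if it meets `{x, f x}` for every `x ∈ S`; elements of `T` outside `S` do no
harm. -/
structure HasUnitGap (D : Digraph V) (f : V → V) (S : Set V) : Prop where
  exists_le : ∃ T B : Finset V, (∀ x ∈ S, x ∈ T ∨ f x ∈ T) ∧ ↑B ⊆ S ∧ D.IsPacking B ∧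
    T.card ≤ B.card + 1
  le : ∀ T B : Finset V, (∀ x ∈ S, x ∈ T ∨ f x ∈ T) → ↑B ⊆ S → D.IsPacking B →
    B.card + 1 ≤ T.card

/-- Inserting a pendant star raises both the domination and the packing number by one. -/
theorem IsPendantStar.hasUnitGap {D : Digraph V} {f : V → V} {S : Set V} {u v : V}
    (h : IsPendantStar f S u v) (hf : D.IsParentMap f) (hS : Set.MapsTo f S S)
    (hgap : HasUnitGap D f (S \ D.closedOutNbhd u)) : HasUnitGap D f S := by
  classical
  constructor
  · obtain ⟨T, B, hT, hBS, hB, hcard⟩ := hgap.exists_le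
    have hBmem : ∀ x ∈ B, x ∈ S ∧ x ≠ u ∧ f x ≠ u := fun x hx =>
      ⟨(hBS hx).1, fun e => (hBS hx).2 (hf.mem_closedOutNbhd.2 (.inl e)),
        fun e => (hBS hx).2 (hf.mem_closedOutNbhd.2 (.inr e))⟩
    have hvB : v ∉ B := fun hv => (hBmem v hv).2.2 h.apply_leaf
    refine ⟨insert u T, insert v B, fun x hx => ?_, ?_, ?_, ?_⟩
    · by_cases hxu : x ∈ D.closedOutNbhd u
      · rw [hf.mem_closedOutNbhd] at hxu
        exact hxu.imp (fun e => Finset.mem_insert.2 (.inl e))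
          (fun e => Finset.mem_insert.2 (.inl e))
      · exact (hT x ⟨hx, hxu⟩).imp Finset.mem_insert_of_mem Finset.mem_insert_of_mem
    · rw [Finset.coe_insert]
      exact Set.insert_subset h.leaf_mem fun x hx => (hBmem x hx).1
    · rw [hf.isPacking_iff] at hB ⊢
      simp only [Finset.coe_insert]
      rintro x (rfl | hx) y (rfl | hy) hxy
      · rfl
      · rw [h.apply_leaf] at hxy
        exact hxy.elim (fun e => absurd e.symm (hBmem y hy).2.2)
          (fun e => absurd e.symm (hBmem y hy).2.1)
      · rw [h.apply_leaf] at hxy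
        exact hxy.elim (fun e => absurd e (hBmem x hx).2.2)
          (fun e => absurd e (h.apply_ne _ h.leaf_mem h.apply_leaf x (hBmem x hx).1))
      · exact hB x hx y hy hxy
    · rw [Finset.card_insert_of_notMem hvB]
      exact (Finset.card_insert_le _ _).trans (by omega)
  · intro T B hT hBS hB
    set S' := S \ D.closedOutNbhd u
    have h1 := hgap.le (T.filter (· ∈ S')) (B.filter (· ∈ S')) (fun x hx => ?_)
      (fun x hx => (Finset.mem_filter.1 hx).2) ?_
    · -- `T` contains the center or the leaf of the star, and `B` at most one vertex of the star.
      have h2 : (T.filter (· ∈ S')).card < T.card := by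
        refine Finset.card_lt_card (Finset.filter_ssubset.2 ?_)
        rcases hT v h.leaf_mem with hv | hv
        · exact ⟨v, hv, fun h' => h'.2 (hf.mem_closedOutNbhd.2 (.inr h.apply_leaf))⟩
        · rw [h.apply_leaf] at hv
          exact ⟨u, hv, fun h' => h'.2 (hf.mem_closedOutNbhd.2 (.inl rfl))⟩
      have h3 : (B.filter (· ∉ S')).card ≤ 1 := by
        refine Finset.card_le_one.2 fun x hx y hy => ?_
        rw [Finset.mem_filter] at hx hy
        have hmem : ∀ x ∈ B, x ∉ S' → x ∈ D.closedOutNbhd u := fun x hx hxS =>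
          not_not.1 fun hxu => hxS ⟨hBS hx, hxu⟩
        exact Set.encard_le_one_iff.1 (hB u) x y ⟨hmem x hx.1 hx.2, hx.1⟩
          ⟨hmem y hy.1 hy.2, hy.1⟩
      have h4 := Finset.card_filter_add_card_filter_not (s := B) (· ∈ S')
      omega
    · simp only [Finset.mem_filter]
      exact (hT x hx.1).imp (fun h' => ⟨h', hx⟩) (fun h' => ⟨h', h.mapsTo_diff hf hS hx⟩)
    · rw [hf.isPacking_iff] at hB ⊢
      exact fun x hx y hy => hB x (Finset.mem_filter.1 hx).1 y (Finset.mem_filter.1 hy).1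

theorem IsParentMap.hasUnitGap_of_odd {D : Digraph V} {f : V → V} (hf : D.IsParentMap f)
    (hloop : D.Loopless) {S : Set V} {k : ℕ} (h : (D.induce S).IsDirectedCycle k) (hk : Odd k) :
    HasUnitGap D f S := by
  classical
  obtain ⟨c, hc, rfl, hstep⟩ := hf.exists_enum_of_isDirectedCycle h
  obtain ⟨m, rfl⟩ := hk
  constructor
  · have hinj : ∀ a b : ℕ, a < 2 * m + 1 → b < 2 * m + 1 → c a = c b → a = b := by
      intro a b ha hb hab
      have := (ZMod.natCast_eq_natCast_iff' _ _ _).1 (hc hab)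
      rwa [Nat.mod_eq_of_lt ha, Nat.mod_eq_of_lt hb] at this
    have hstep' : ∀ a : ℕ, f (c (a + 1 : ℕ)) = c a := fun a => by
      rw [Nat.cast_add, Nat.cast_one, hstep]
    refine ⟨(Finset.range (m + 1)).image fun j => c (2 * j : ℕ),
      (Finset.range m).image fun j => c (2 * j + 1 : ℕ), ?_, ?_, ?_, ?_⟩
    · rintro _ ⟨i, rfl⟩
      have hi := ZMod.val_lt i
      rw [← ZMod.natCast_zmod_val i]
      simp only [Finset.mem_image, Finset.mem_range]
      rcases Nat.even_or_odd' i.val with ⟨j, hj | hj⟩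
      · exact .inl ⟨j, by omega, by rw [hj]⟩
      · exact .inr ⟨j, by omega, by rw [hj, hstep']⟩
    · intro x hx
      obtain ⟨j, -, rfl⟩ := Finset.mem_image.1 hx
      exact ⟨_, rfl⟩
    · rw [hf.isPacking_iff]
      simp only [Finset.mem_coe, Finset.mem_image, Finset.mem_range]
      rintro _ ⟨i, hi, rfl⟩ _ ⟨j, hj, rfl⟩ hij
      rw [hstep', hstep'] at hij
      rcases hij with hij | hij
      · have := hinj _ _ (by omega) (by omega) hij
        rw [this]
      · have := hinj _ _ (by omega) (by omega) hij
        omega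
    · rw [Finset.card_image_of_injOn (s := Finset.range m), Finset.card_range]
      · exact Finset.card_image_le.trans (by rw [Finset.card_range])
      · intro i hi j hj hij
        simp only [Finset.coe_range, Set.mem_Iio] at hi hj
        have := hinj _ _ (by omega) (by omega) hij
        omega
  · intro T B hT hBS hB
    rw [hf.isPacking_iff] at hB
    -- In terms of indices, `T` and its shift by one cover the cycle, while `B` and its shift by
    -- one are disjoint; as the length is odd, neither of them is half of it.
    have hshift : Injective fun i : ZMod (2 * m + 1) => i + 1 := add_left_injective 1
    let A : Finset (ZMod (2 * m + 1)) := Finset.univ.filter (c · ∈ T)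
    let J : Finset (ZMod (2 * m + 1)) := Finset.univ.filter (c · ∈ B)
    have hAT : A.card ≤ T.card :=
      Finset.card_le_card_of_injOn c (fun i hi => (Finset.mem_filter.1 hi).2) hc.injOn
    have hBJ : B.card ≤ J.card := by
      have : B ⊆ J.image c := fun x hx => by
        obtain ⟨i, rfl⟩ := hBS hx
        exact Finset.mem_image_of_mem c (Finset.mem_filter.2 ⟨Finset.mem_univ _, hx⟩)
      exact (Finset.card_le_card this).trans Finset.card_image_le
    have hA : 2 * m + 1 ≤ A.card + A.card := by
      have : (Finset.univ : Finset (ZMod (2 * m + 1))) ⊆ A ∪ A.image (· + 1) := by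
        intro i _
        rw [Finset.mem_union]
        rcases hT (c i) ⟨i, rfl⟩ with hi | hi
        · exact .inl (Finset.mem_filter.2 ⟨Finset.mem_univ _, hi⟩)
        · refine .inr (Finset.mem_image.2 ⟨i - 1, ?_, sub_add_cancel _ _⟩)
          rw [← sub_add_cancel i 1, hstep] at hi
          exact Finset.mem_filter.2 ⟨Finset.mem_univ _, hi⟩
      have h1 := Finset.card_le_card this
      have h2 := Finset.card_union_le A (A.image (· + 1))
      rw [Finset.card_univ, ZMod.card] at h1
      rw [Finset.card_image_of_injective _ hshift] at h2
      omega
    have hJ : J.card + J.card ≤ 2 * m + 1 := by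
      have : Disjoint J (J.image (· + 1)) := by
        rw [Finset.disjoint_left]
        intro i hi hi'
        obtain ⟨j, hj, rfl⟩ := Finset.mem_image.1 hi'
        have := hB _ (Finset.mem_filter.1 hi).2 _ (Finset.mem_filter.1 hj).2 (.inr (hstep j))
        exact hf.apply_ne hloop (c (j + 1)) ((hstep j).trans this.symm)
      have h1 := Finset.card_le_univ (J ∪ J.image (· + 1))
      rwa [Finset.card_union_of_disjoint this, Finset.card_image_of_injective _ hshift,
        ZMod.card] at h1
    omega

/-! ### Elimination sequences -/

theorem IsRDSES.reflTransGen {D : Digraph V} {p : ℕ} {S : Fin (p + 1) → Set V}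
    (h : D.IsRDSES p S) :
    Relation.ReflTransGen D.StarElimStep Set.univ (S (Fin.last p)) := by
  suffices ∀ i, Relation.ReflTransGen D.StarElimStep Set.univ (S i) from this _
  intro i
  induction i using Fin.induction with
  | zero => rw [h.start]
  | succ i ih => exact ih.tail (h.step i)

theorem exists_isRDSES {D : Digraph V} {S : Set V}
    (h : Relation.ReflTransGen D.StarElimStep Set.univ S)
    (hlast : (∃ k, (D.induce S).IsDirectedCycle k) ∨ (D.induce S).height = 1) :
    ∃ (p : ℕ) (s : Fin (p + 1) → Set V), D.IsRDSES p s ∧ s (Fin.last p) = S := by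
  have key : ∃ (p : ℕ) (s : ℕ → Set V), s 0 = Set.univ ∧ s p = S ∧
      ∀ i < p, D.StarElimStep (s i) (s (i + 1)) := by
    clear hlast
    induction h with
    | refl => exact ⟨0, fun _ => Set.univ, rfl, rfl, by simp⟩
    | @tail S S' _ hstep ih =>
      obtain ⟨p, s, h0, hp, hs⟩ := ih
      refine ⟨p + 1, fun i => if i ≤ p then s i else S', by simp [h0], by simp, fun i hi => ?_⟩
      rcases Nat.lt_succ_iff_lt_or_eq.1 hi with hi | rfl
      · simpa [hi.le, Nat.succ_le_of_lt hi] using hs i hi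
      · simpa [hp] using hstep
  obtain ⟨p, s, h0, rfl, hs⟩ := key
  exact ⟨p, fun i => s i, ⟨h0, fun i => hs i i.2, hlast⟩, rfl⟩

theorem IsParentMap.hasUnitGap_of_reflTransGen [Finite V] {D : Digraph V} {f : V → V}
    (hf : D.IsParentMap f) (hloop : D.Loopless) {S S' : Set V}
    (h : Relation.ReflTransGen D.StarElimStep S S') (hS : Set.MapsTo f S S)
    (hgap : HasUnitGap D f S') : HasUnitGap D f S := by
  induction h using Relation.ReflTransGen.head_induction_on with
  | refl => exact hgap
  | head hstep _ ih =>
    obtain ⟨u, v, hstar, rfl⟩ := hstep.exists_isPendantStar hf hloop hS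
    exact hstar.hasUnitGap hf hS (ih (hstar.mapsTo_diff hf hS))

/-- Elimination from a set closed under taking parents leads to an odd cycle, unless the set has a
kernel. -/
theorem IsParentMap.exists_reflTransGen_or_isKernelOn [Finite V] {D : Digraph V} {f : V → V}
    (hf : D.IsParentMap f) (hloop : D.Loopless) (hconn : D.IsConnected) (S : Set V)
    (hS : Set.MapsTo f S S) (hne : S.Nonempty) :
    (∃ S', Relation.ReflTransGen D.StarElimStep S S' ∧
      ∃ k, Odd k ∧ (D.induce S').IsDirectedCycle k) ∨ ∃ K, IsKernelOn f S K := by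
  induction S using WellFoundedLT.induction with
  | ind S ih =>
  by_cases hh : 2 ≤ (D.induce S).height
  · obtain ⟨S', hstep⟩ := exists_starElimStep hf hloop hS hh
    obtain ⟨u, v, hstar, rfl⟩ := hstep.exists_isPendantStar hf hloop hS
    have hlt : S \ D.closedOutNbhd u < S := by
      refine Set.sdiff_subset.ssubset_of_mem_notMem hstar.center_mem fun h' => ?_
      exact h'.2 (hf.mem_closedOutNbhd.2 (.inl rfl))
    refine (ih _ hlt (hstar.mapsTo_diff hf hS) (hstar.nonempty_diff hf hloop hS)).imp ?_ ?_
    · rintro ⟨S'', h, hk⟩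
      exact ⟨S'', h.head hstep, hk⟩
    · rintro ⟨K, hK⟩
      exact hstar.exists_isKernelOn hf hloop hK
  · rcases isDirectedCycle_or_exists_leaf hf hloop hconn hS hne hh with
      ⟨k, hk⟩ | ⟨v, hv, hleaf, hper⟩
    · rcases Nat.even_or_odd k with he | ho
      · exact .inr (hf.exists_isKernelOn_of_even hk he)
      · exact .inl ⟨S, .refl, k, ho, hk⟩
    · exact .inr (exists_isKernelOn_of_leaf
        (fun x _ => hf.exists_iterate_eq_of_mem_periodicPts hconn hper x) hv hleaf rfl)

end Digraph

open Digraph in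
theorem mainTheorem2 {V : Type*} [Finite V] (D : Digraph V) (hloop : D.Loopless)
    (hconn : D.IsConnected) (hcontra : D.IsContrafunctional) :
    (D.MemOmega → D.dominationNumber = D.packingNumber + 1) ∧
      (¬ D.MemOmega → D.dominationNumber = D.packingNumber) := by
  obtain ⟨f, hf⟩ := hcontra.exists_isParentMap
  constructor
  · rintro ⟨-, -, -, p, S, hS, k, hk, hcyc⟩
    have hgap := hf.hasUnitGap_of_reflTransGen hloop hS.reflTransGen (Set.mapsTo_univ _ _)
      (hf.hasUnitGap_of_odd hloop hcyc hk)
    obtain ⟨T, B, hT, -, hB, hTB⟩ := hgap.exists_le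
    refine dominationNumber_eq_packingNumber_add
      (hf.isDominating_iff.2 fun x => hT x trivial) hB hTB fun T B hT hB => ?_
    exact hgap.le T B (fun x _ => hf.isDominating_iff.1 hT x) (Set.subset_univ _) hB
  · intro hΩ
    have hne : (Set.univ : Set V).Nonempty := @Set.univ_nonempty V hconn.nonempty
    rcases hf.exists_reflTransGen_or_isKernelOn hloop hconn Set.univ (Set.mapsTo_univ _ _) hne with
      ⟨S, hS, k, hk, hcyc⟩ | ⟨K, hK⟩
    · obtain ⟨p, s, hs, rfl⟩ := exists_isRDSES hS (.inl ⟨k, hcyc⟩)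
      exact absurd ⟨hloop, hconn, hcontra, p, s, hs, k, hk, hcyc⟩ hΩ
    · obtain ⟨T, B, hT, hB, hTB⟩ := hf.exists_card_eq_of_isKernelOn hK
      exact dominationNumber_eq_packingNumber_add (e := 0) hT hB hTB.le
        fun T B hT hB => hf.card_le_card hT hB
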